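/- **Setting.** Let $\mathsf G=\langle S_\Diamond,S_\Box,\bar s,A,\delta\rangle$ be a turn-based stochastic two-player game: $S=S_\Diamond\uplus S_\Box$ and $A$ are finite, $\bar s\in S$ is the initial state, and $\delta$ is a partial function assigning to $(s,a)\in S\times A$ a probability distribution on $S$. Let $A(s)$ be the set of actions $a$ for which $\delta(s,a)$ is defined, and assume $A(s)\neq\emptyset$ for all $s$. Let $r:S\times A\to\mathbb R_{\ge0}$ be a reward structure, $b\in\mathbb R$, and $\psi:S_\Diamond\times A\to\mathbb R_{\ge0}$ a penalty function. Controller strategies $\sigma$ and environment strategies $\pi$ are memoryless and randomised, and choose only enabled actions. $E_s^{\sigma,\pi}(r)$ is the expected total reward $\int\sum_{j\ge0}r(s_j,a_j)\,d\mathrm{Pr}_s^{\sigma,\pi}$ over infinite paths $s_0a_0s_1a_1\dots$ from $s$. Assume $\sup_{\sigma,\pi}E_s^{\sigma,\pi}(r)<\infty$ for every $s\in S$. A multi-strategy $\theta$ assigns to each $s\in S_\Diamond$ a probability distribution on the nonempty subsets of $A(s)$; it is deterministic if all these distributions are Dirac. A controller strategy $\sigma$ complies with $\theta$ if for every $s\in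 S_\Diamond$ there are distributions $d_{s,B}$ on $B$ (for $\emptyset\ne B\subseteq A(s)$) with $\sigma(s)(a)=\sum_{B\ni a}\theta(s)(B)\,d_{s,B}(a)$ for all $a\in A(s)$. $\theta$ is sound (for the property that the expected total reward is at least $b$) if $E_{\bar s}^{\sigma,\pi}(r)\ge b$ for all $\sigma$ complying with $\theta$ and all $\pi$. The static penalty is $\mathrm{pen}_\psi(\theta)=\sum_{s\in S_\Diamond}\sum_{B\subseteq A(s)}\sum_{a\in A(s)\setminus B}\theta(s)(B)\,\psi(s,a)$. A sound deterministic multi-strategy is optimally permissive if its static penalty is the infimum of the static penalties of all sound deterministic multi-strategies. **MILP.** For a reward structure $r$, a bound $b$ and a penalty function $\psi$, $\mathrm{MILP}(r,b,\psi)$ has variables $x_s\in[0,1]$, $y_{s,a}\in\{0,1\}$, $\alpha_s\in\{0,1\}$, $\beta_{s,a,t}\in\{0,1\}$, $\gamma_s\in[0,1]$ ($s,t\in S$, $a\in A$): minimise $-x_{\bar s}+\sum_{s\in S_\Diamond}\sum_{a\in A(s)}(1-y_{s,a})\psi(s,a)$ subject to - $x_{\bar s}\ge b$; - $1\le\sum_{a\in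 A(s)}y_{s,a}$ for $s\in S_\Diamond$; - $x_s\le\sum_{t\in S}\delta(s,a)(t)\,x_t+r(s,a)+(1-y_{s,a})$ for $s\in S_\Diamond$, $a\in A(s)$; - $x_s\le\sum_{t\in S}\delta(s,a)(t)\,x_t+r(s,a)$ for $s\in S_\Box$, $a\in A(s)$; - $x_s\le\alpha_s$ for $s\in S$; - $y_{s,a}=(1-\alpha_s)+\sum_{t\in\mathrm{supp}\,\delta(s,a)}\beta_{s,a,t}$ for $s\in S$, $a\in A(s)$; - $y_{s,a}=1$ for $s\in S_\Box$, $a\in A(s)$; - $\gamma_t<\gamma_s+(1-\beta_{s,a,t})+r(s,a)$ for $s\in S$, $a\in A(s)$, $t\in\mathrm{supp}\,\delta(s,a)$. **Scaling.** Call $c,k>0$ admissible scaling factors if $\sup_{\sigma,\pi}E_s^{\sigma,\pi}(c\,r)<1$ for every $s\in S$, and any two different values of the static penalty $\mathrm{pen}_{k\psi}$ on deterministic multi-strategies differ by at least $1$. **Theorem.** Admissible scaling factors exist. For all admissible $c,k$ and every $p\in\mathbb R$: there is an optimally permissive sound deterministic multi-strategy in $\mathsf G$ with static penalty $\mathrm{pen}_\psi(\theta)=p$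 if and only if there is an optimal assignment to $\mathrm{MILP}(c\,r,\,c\,b,\,k\,\psi)$ which satisfies $p=\sum_{s\in S_\Diamond}\sum_{a\in A(s)}(1-y_{s,a})\,\psi(s,a)$. -/

import Mathlib

open scoped NNReal ENNReal

noncomputable section

namespace PermissiveSynthesis

/-- A turn-based stochastic two-player game with state space `S` and action set `A`.
States in `diamond` belong to the controller, all other states to the environment.
The partial transition function is given by its domain `enabled` and by `δ`; the value of
`δ s a` for `a ∉ enabled s` is irrelevant. Every state has an enabled action. -/
structure Game (S A : Type*) where
  diamond : Finset S
  init : S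
  enabled : S → Finset A
  enabled_nonempty : ∀ s, (enabled s).Nonempty
  δ : S → A → PMF S

variable {S A : Type*}

namespace Game

/-- Controller states. -/
abbrev Ctrl (G : Game S A) : Type _ := {s : S // s ∈ G.diamond}

/-- Environment states. -/
abbrev Env (G : Game S A) : Type _ := {s : S // s ∉ G.diamond}

/-- A memoryless (randomised) controller strategy. -/
structure CtrlStrategy (G : Game S A) where
  act : G.Ctrl → PMF A
  enabled : ∀ s, ∀ a ∈ (act s).support, a ∈ G.enabled s

/-- A memoryless (randomised) environment strategy. -/
structure EnvStrategy (G : Game S A) where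
  act : G.Env → PMF A
  enabled : ∀ s, ∀ a ∈ (act s).support, a ∈ G.enabled s

end Game

/-- One step `(sᵢ, aᵢ)` of a path `s₀ a₀ s₁ a₁ …`. -/
def Step (S A : Type*) : Type _ := S × A

instance : MeasurableSpace (Step S A) := ⊤

instance : DiscreteMeasurableSpace (Step S A) := ⟨fun _ => trivial⟩

instance [Finite S] [Finite A] : Countable (Step S A) :=
  inferInstanceAs (Countable (S × A))

namespace Game

variable [DecidableEq S]

/-- The distribution of the action taken in state `s` under the strategies `σ` and `π`. -/
def choice (G : Game S A) (σ : G.CtrlStrategy) (π : G.EnvStrategy) (s : S) : PMF A :=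
  if h : s ∈ G.diamond then σ.act ⟨s, h⟩ else π.act ⟨s, h⟩

/-- The distribution of the first step `(s, a)` from `s`. -/
def firstStep (G : Game S A) (σ : G.CtrlStrategy) (π : G.EnvStrategy) (s : S) :
    PMF (Step S A) :=
  (G.choice σ π s).map fun a => (s, a)

/-- The distribution of the step following the step `e`. -/
def nextStep (G : Game S A) (σ : G.CtrlStrategy) (π : G.EnvStrategy) (e : Step S A) :
    PMF (Step S A) :=
  (G.δ e.1 e.2).bind fun t => G.firstStep σ π t

/-- The transition kernel of the induced process; it depends on the last step only. -/
def stepKernel [Finite S] [Finite A] (G : Game S A) (σ : G.CtrlStrategy) (π : G.EnvStrategy)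
    (n : ℕ) : ProbabilityTheory.Kernel (Finset.Iic n → Step S A) (Step S A) :=
  ProbabilityTheory.Kernel.ofFunOfCountable fun h =>
    (G.nextStep σ π (h ⟨n, Finset.mem_Iic.2 le_rfl⟩)).toMeasure

instance [Finite S] [Finite A] (G : Game S A) (σ : G.CtrlStrategy) (π : G.EnvStrategy) (n : ℕ) :
    ProbabilityTheory.IsMarkovKernel (G.stepKernel σ π n) :=
  ⟨fun h => by
    change MeasureTheory.IsProbabilityMeasure
      ((G.nextStep σ π (h ⟨n, Finset.mem_Iic.2 le_rfl⟩)).toMeasure)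
    infer_instance⟩

/-- The probability measure on infinite paths from `s` induced by `σ` and `π`, as a measure on
all sequences of steps. -/
def pathMeasure [Finite S] [Finite A] (G : Game S A) (σ : G.CtrlStrategy) (π : G.EnvStrategy)
    (s : S) : MeasureTheory.Measure (ℕ → Step S A) :=
  ProbabilityTheory.Kernel.trajMeasure (X := fun _ => Step S A)
    (G.firstStep σ π s).toMeasure (G.stepKernel σ π)

/-- The expected total reward for `r` from `s` under `σ` and `π`, possibly `∞`. -/
def expReward [Finite S] [Finite A] (G : Game S A) (r : S → A → ℝ≥0)
    (σ : G.CtrlStrategy) (π : G.EnvStrategy) (s : S) : ℝ≥0∞ :=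
  ∫⁻ ω, ∑' j : ℕ, (r (ω j).1 (ω j).2 : ℝ≥0∞) ∂(G.pathMeasure σ π s)

/-- The maximum possible reward `sup_{σ,π} E_s^{σ,π}(r)` from `s`. -/
def maxReward [Finite S] [Finite A] (G : Game S A) (r : S → A → ℝ≥0) (s : S) : ℝ≥0∞ :=
  ⨆ (σ : G.CtrlStrategy) (π : G.EnvStrategy), G.expReward r σ π s

/-- `σ` is sound for the property "the expected total reward for `r` from the initial state is
at least `b`". As rewards are nonnegative, a negative `b` imposes nothing, in accordance with
`ENNReal.ofReal b = 0`. -/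
def CtrlStrategy.Sound [Finite S] [Finite A] {G : Game S A} (σ : G.CtrlStrategy)
    (r : S → A → ℝ≥0) (b : ℝ) : Prop :=
  ∀ π : G.EnvStrategy, ENNReal.ofReal b ≤ G.expReward r σ π G.init

/-- A memoryless (randomised) multi-strategy: to each controller state a distribution over the
nonempty sets of enabled actions. -/
structure MultiStrategy (G : Game S A) where
  allow : G.Ctrl → PMF (Finset A)
  nonempty : ∀ s, ∀ B ∈ (allow s).support, B.Nonempty
  enabled : ∀ s, ∀ B ∈ (allow s).support, B ⊆ G.enabled s

namespace MultiStrategy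

variable {G : Game S A}

/-- A multi-strategy is deterministic if it always returns a Dirac distribution. -/
def Deterministic (θ : G.MultiStrategy) : Prop :=
  ∀ s, ∃ B : Finset A, θ.allow s = PMF.pure B

/-- `σ` complies with `θ`. -/
def Complies [DecidableEq A] (θ : G.MultiStrategy) (σ : G.CtrlStrategy) : Prop :=
  ∀ s : G.Ctrl, ∃ d : Finset A → PMF A,
    (∀ B : Finset A, B.Nonempty → B ⊆ G.enabled s → ∀ a ∈ (d B).support, a ∈ B) ∧
    ∀ a ∈ G.enabled s,
      σ.act s a = ∑ B ∈ (G.enabled s).powerset with a ∈ B, θ.allow s B * d B a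

/-- `θ` is sound: every compliant controller strategy is sound. -/
def Sound [Finite S] [Finite A] [DecidableEq A] (θ : G.MultiStrategy)
    (r : S → A → ℝ≥0) (b : ℝ) : Prop :=
  ∀ σ : G.CtrlStrategy, θ.Complies σ → σ.Sound r b

/-- The local penalty of `θ` in the controller state `s`. -/
def localPenalty [DecidableEq A] (θ : G.MultiStrategy) (ψ : G.Ctrl → A → ℝ≥0)
    (s : G.Ctrl) : ℝ :=
  ∑ B ∈ (G.enabled s).powerset, ∑ a ∈ G.enabled s \ B, (θ.allow s B).toReal * (ψ s a : ℝ)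

/-- The static penalty of `θ`. -/
def staticPenalty [Fintype S] [DecidableEq A] (θ : G.MultiStrategy)
    (ψ : G.Ctrl → A → ℝ≥0) : ℝ :=
  ∑ s : G.Ctrl, θ.localPenalty ψ s

/-- `θ` is a sound deterministic multi-strategy that is optimally permissive among these for the
static penalty scheme given by `ψ`. -/
def OptimallyPermissive [Fintype S] [Finite A] [DecidableEq A] (θ : G.MultiStrategy)
    (r : S → A → ℝ≥0) (b : ℝ) (ψ : G.Ctrl → A → ℝ≥0) : Prop :=
  θ.Deterministic ∧ θ.Sound r b ∧
    IsGLB {q : ℝ | ∃ θ' : G.MultiStrategy,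
      θ'.Deterministic ∧ θ'.Sound r b ∧ q = θ'.staticPenalty ψ} (θ.staticPenalty ψ)

end MultiStrategy

/-- The scaling conditions: the maximum possible reward is below `1` in every state, and
different static penalties of deterministic multi-strategies differ by at least `1`. -/
def Rescaled [Fintype S] [Finite A] [DecidableEq A] (G : Game S A) (r : S → A → ℝ≥0)
    (ψ : G.Ctrl → A → ℝ≥0) : Prop :=
  (∀ s, G.maxReward r s < 1) ∧
    ∀ θ θ' : G.MultiStrategy, θ.Deterministic → θ'.Deterministic →
      θ.staticPenalty ψ ≠ θ'.staticPenalty ψ → 1 ≤ |θ.staticPenalty ψ - θ'.staticPenalty ψ|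

end Game

/-- An assignment to the variables of the MILP. -/
structure Assignment (S A : Type*) where
  x : S → ℝ
  y : S → A → ℝ
  α : S → ℝ
  β : S → A → S → ℝ
  γ : S → ℝ

namespace Game

open Classical in
/-- The support of `δ s a`. -/
def succ [Fintype S] (G : Game S A) (s : S) (a : A) : Finset S :=
  Finset.univ.filter fun t => t ∈ (G.δ s a).support

/-- The MILP constraints for the reward structure `r` and the bound `b`. -/
structure Feasible [Fintype S] (G : Game S A) (r : S → A → ℝ≥0) (b : ℝ)
    (v : Assignment S A) : Prop where
  x_range : ∀ s, 0 ≤ v.x s ∧ v.x s ≤ 1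
  y_range : ∀ s a, v.y s a = 0 ∨ v.y s a = 1
  α_range : ∀ s, v.α s = 0 ∨ v.α s = 1
  β_range : ∀ s a t, v.β s a t = 0 ∨ v.β s a t = 1
  γ_range : ∀ s, 0 ≤ v.γ s ∧ v.γ s ≤ 1
  bound : b ≤ v.x G.init
  allowed : ∀ s ∈ G.diamond, 1 ≤ ∑ a ∈ G.enabled s, v.y s a
  ctrl : ∀ s ∈ G.diamond, ∀ a ∈ G.enabled s,
    v.x s ≤ ∑ t, (G.δ s a t).toReal * v.x t + r s a + (1 - v.y s a)
  env : ∀ s ∉ G.diamond, ∀ a ∈ G.enabled s,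
    v.x s ≤ ∑ t, (G.δ s a t).toReal * v.x t + r s a
  positive : ∀ s, v.x s ≤ v.α s
  select : ∀ s, ∀ a ∈ G.enabled s, v.y s a = (1 - v.α s) + ∑ t ∈ G.succ s a, v.β s a t
  env_allowed : ∀ s ∉ G.diamond, ∀ a ∈ G.enabled s, v.y s a = 1
  ranking : ∀ s, ∀ a ∈ G.enabled s, ∀ t ∈ G.succ s a,
    v.γ t < v.γ s + (1 - v.β s a t) + r s a

/-- The penalty term `∑_{s ∈ S_◇} ∑_{a ∈ A(s)} (1 - y_{s,a}) ψ(s,a)`. -/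
def penaltyTerm [Fintype S] [DecidableEq S] (G : Game S A) (ψ : G.Ctrl → A → ℝ≥0)
    (v : Assignment S A) : ℝ :=
  ∑ s : G.Ctrl, ∑ a ∈ G.enabled s, (1 - v.y s a) * (ψ s a : ℝ)

/-- The objective function, to be minimised. -/
def objective [Fintype S] [DecidableEq S] (G : Game S A) (ψ : G.Ctrl → A → ℝ≥0)
    (v : Assignment S A) : ℝ :=
  - v.x G.init + G.penaltyTerm ψ v

/-- `v` is an optimal assignment of the MILP instance. -/
def OptimalAssignment [Fintype S] [DecidableEq S] (G : Game S A) (r : S → A → ℝ≥0) (b : ℝ)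
    (ψ : G.Ctrl → A → ℝ≥0) (v : Assignment S A) : Prop :=
  G.Feasible r b v ∧ ∀ w, G.Feasible r b w → G.objective ψ v ≤ G.objective ψ w

end Game

end PermissiveSynthesis

end

/-!
Rewards and penalties are scaled so that every expected total reward is below `1` and different
penalties of deterministic multi-strategies are at least `1` apart. The objective
`-x_init + penalty` therefore orders assignments by penalty first, and the theorem follows once
feasible assignments correspond to sound deterministic multi-strategies with the same penalty.

A deterministic multi-strategy is a family `B` of allowed sets of actions (`IsAllowance`), and a
strategy complies with it iff it plays actions in `B` only. The infimum of the expected rewards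
over compliant and environment strategies is the least fixed point `value r B` of the Bellman
operator that minimises over `B`: it bounds `expReward` from below because `expReward` satisfies
the Bellman equation of the strategies (`expReward_eq`), and the greedy strategies attain it because
`expReward` is the least prefixed point of that equation (`expReward_le_of_prefixed`). Both facts
about `expReward` come from computing the marginals of the path measure. Soundness thus becomes
`b ≤ value r B init` (`IsAllowance.sound_iff`), and the rest of the argument concerns `value` only.

* From `B` to an assignment (`exists_feasible`): take `x = value r B`, and let `α` mark the set `U`
  of states where a positive reward is reachable whatever actions in `B` are played. Steps towards
  such a reward provide the ranking `γ` (`exists_ranking`). Off `U` the value is zero, and all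
  actions are allowed there, which can only lower the penalty.
* From an assignment to `B` (`Feasible.x_le_value`): the Bellman inequalities alone do not bound `x`
  by the least fixed point, since `x - value` may be constant and positive on a closed set of
  states. Rewards make the value decrease on average along the play, so there are none where it is
  minimal on that set. These states again form a closed set, with `α = 1` and without rewards, which
  the ranking `γ` excludes.

The penalty of an optimal assignment is then minimal among all sound deterministic multi-strategies
(`OptimalAssignment.penaltyTerm_le`), and optimal assignments exist as soon as one such
multi-strategy does (`exists_optimalAssignment`), because there are finitely many of these.
-/

noncomputable section

namespace PermissiveSynthesis

/-! ### Means of `ℝ≥0∞`-valued functions under a `PMF` -/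

/-- The mean of `f` under the discrete distribution `p`. -/
def mean {α : Type*} (p : PMF α) (f : α → ℝ≥0∞) : ℝ≥0∞ :=
  ∑' a, p a * f a

section Mean

variable {α β : Type*}

lemma mean_mono (p : PMF α) {f g : α → ℝ≥0∞} (h : f ≤ g) : mean p f ≤ mean p g :=
  ENNReal.tsum_le_tsum fun a => mul_le_mul_right (h a) _

lemma mean_pure (a : α) (f : α → ℝ≥0∞) : mean (PMF.pure a) f = f a := by
  rw [mean, tsum_eq_single a fun b hb => by simp [hb]]
  simp

lemma mean_bind (p : PMF α) (q : α → PMF β) (f : β → ℝ≥0∞) :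
    mean (p.bind q) f = mean p fun a => mean (q a) f := by
  simp only [mean, PMF.bind_apply, ← ENNReal.tsum_mul_right, ← ENNReal.tsum_mul_left, mul_assoc]
  exact ENNReal.tsum_comm

lemma mean_map (p : PMF α) (g : α → β) (f : β → ℝ≥0∞) :
    mean (p.map g) f = mean p fun a => f (g a) := by
  simp [PMF.map, mean_bind, mean_pure]

lemma mean_tsum {ι : Type*} (p : PMF α) (f : ι → α → ℝ≥0∞) :
    mean p (fun a => ∑' i, f i a) = ∑' i, mean p (f i) := by
  simp only [mean, ← ENNReal.tsum_mul_left]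
  exact ENNReal.tsum_comm

lemma mean_sum {ι : Type*} (s : Finset ι) (p : PMF α) (f : ι → α → ℝ≥0∞) :
    mean p (fun a => ∑ i ∈ s, f i a) = ∑ i ∈ s, mean p (f i) := by
  simp only [mean, Finset.mul_sum]
  exact Summable.tsum_finsetSum fun _ _ => ENNReal.summable

lemma le_mean_of_support (p : PMF α) (f : α → ℝ≥0∞) (c : ℝ≥0∞)
    (h : ∀ a ∈ p.support, c ≤ f a) : c ≤ mean p f := by
  have hc : c = ∑' a, p a * c := by rw [ENNReal.tsum_mul_right, p.tsum_coe, one_mul]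
  rw [hc]
  refine ENNReal.tsum_le_tsum fun a => ?_
  by_cases ha : a ∈ p.support
  · exact mul_le_mul_right (h a ha) _
  · simp [(PMF.apply_eq_zero_iff p a).2 ha]

lemma mean_eq_zero_of_support (p : PMF α) (f : α → ℝ≥0∞) (h : ∀ a ∈ p.support, f a = 0) :
    mean p f = 0 := by
  refine ENNReal.tsum_eq_zero.2 fun a => ?_
  by_cases ha : a ∈ p.support
  · simp [h a ha]
  · simp [(PMF.apply_eq_zero_iff p a).2 ha]

lemma mean_ne_top [Fintype α] (p : PMF α) {f : α → ℝ≥0∞} (h : ∀ a, f a ≠ ⊤) : mean p f ≠ ⊤ := by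
  rw [mean, tsum_fintype]
  exact ENNReal.sum_ne_top.2 fun a _ => ENNReal.mul_ne_top (p.apply_ne_top a) (h a)

lemma toReal_mean [Fintype α] (p : PMF α) {f : α → ℝ≥0∞} (h : ∀ a, f a ≠ ⊤) :
    (mean p f).toReal = ∑ a, (p a).toReal * (f a).toReal := by
  rw [mean, tsum_fintype,
    ENNReal.toReal_sum fun a _ => ENNReal.mul_ne_top (p.apply_ne_top a) (h a)]
  simp

lemma lintegral_toMeasure [MeasurableSpace α] [Countable α] [MeasurableSingletonClass α]
    (p : PMF α) (f : α → ℝ≥0∞) : ∫⁻ a, f a ∂p.toMeasure = mean p f := by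
  rw [MeasureTheory.lintegral_countable', mean]
  refine tsum_congr fun a => ?_
  rw [PMF.toMeasure_apply_singleton _ _ (measurableSet_singleton a), mul_comm]

end Mean

namespace Game

variable {S A : Type*}

/-! ### The Bellman equation for the expected total reward -/

section Bellman

variable [DecidableEq S]

/-- The mean of `f` over the step following a given step. -/
def stepMean (G : Game S A) (σ : G.CtrlStrategy) (π : G.EnvStrategy)
    (f : Step S A → ℝ≥0∞) (e : Step S A) : ℝ≥0∞ :=
  mean (G.nextStep σ π e) f

lemma mean_firstStep (G : Game S A) (σ : G.CtrlStrategy) (π : G.EnvStrategy) (s : S)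
    (f : Step S A → ℝ≥0∞) :
    mean (G.firstStep σ π s) f = mean (G.choice σ π s) fun a => f (s, a) :=
  mean_map _ _ _

lemma stepMean_apply (G : Game S A) (σ : G.CtrlStrategy) (π : G.EnvStrategy)
    (f : Step S A → ℝ≥0∞) (e : Step S A) :
    G.stepMean σ π f e = mean (G.δ e.1 e.2) fun t => mean (G.firstStep σ π t) f :=
  mean_bind _ _ _

variable [Finite S] [Finite A]

lemma lintegral_pathMeasure_zero (G : Game S A) (σ : G.CtrlStrategy) (π : G.EnvStrategy) (s : S)
    (f : Step S A → ℝ≥0∞) :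
    ∫⁻ ω, f (ω 0) ∂(G.pathMeasure σ π s) = mean (G.firstStep σ π s) f := by
  have h0 : (G.pathMeasure σ π s).map (Preorder.frestrictLe (π := fun _ => Step S A) 0) =
      (G.firstStep σ π s).toMeasure.map
        (MeasurableEquiv.piUnique (fun _ : Finset.Iic 0 => Step S A)).symm := by
    rw [pathMeasure, ProbabilityTheory.Kernel.trajMeasure,
      MeasureTheory.Measure.map_comp _ _ (by fun_prop),
      ProbabilityTheory.Kernel.traj_map_frestrictLe, ProbabilityTheory.Kernel.partialTraj_self,
      MeasureTheory.Measure.id_comp]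
  have h1 : ∫⁻ ω, f (ω 0) ∂(G.pathMeasure σ π s) =
      ∫⁻ h, f (h ⟨0, Finset.mem_Iic.2 le_rfl⟩) ∂(G.pathMeasure σ π s).map
        (Preorder.frestrictLe (π := fun _ => Step S A) 0) := by
    rw [MeasureTheory.lintegral_map]
    · rfl
    · exact (measurable_of_countable f).comp (measurable_pi_apply _)
    · fun_prop
  rw [h1, h0, MeasureTheory.lintegral_map, ← lintegral_toMeasure]
  · rfl
  · exact (measurable_of_countable f).comp (measurable_pi_apply _)
  · fun_prop

lemma lintegral_pathMeasure_succ (G : Game S A) (σ : G.CtrlStrategy) (π : G.EnvStrategy) (s : S)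
    (f : Step S A → ℝ≥0∞) (n : ℕ) :
    ∫⁻ ω, f (ω (n + 1)) ∂(G.pathMeasure σ π s) =
      ∫⁻ ω, G.stepMean σ π f (ω n) ∂(G.pathMeasure σ π s) := by
  have hf : Measurable f := measurable_of_countable f
  have h := ProbabilityTheory.Kernel.map_frestrictLe_trajMeasure_compProd_eq_map_trajMeasure
    (X := fun _ => Step S A) (μ₀ := (G.firstStep σ π s).toMeasure) (κ := G.stepKernel σ π) (a := n)
  change ((G.pathMeasure σ π s).map _).compProd _ = (G.pathMeasure σ π s).map _ at h
  have hf2 : Measurable fun q : (Finset.Iic n → Step S A) × Step S A => f q.2 :=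
    hf.comp measurable_snd
  have h' := congrArg (fun μ => ∫⁻ q, f q.2 ∂μ) h
  rw [MeasureTheory.lintegral_map hf2 (by fun_prop),
    MeasureTheory.Measure.lintegral_compProd hf2,
    MeasureTheory.lintegral_map (Measurable.lintegral_kernel_prod_right' hf2) (by fun_prop)] at h'
  rw [← h']
  refine MeasureTheory.lintegral_congr fun ω => ?_
  exact (lintegral_toMeasure (G.nextStep σ π (ω n)) f)

/-- The law of the `n`-th step, in dual form: iterating `stepMean` on `f` moves the time at which
`f` is evaluated back to the first step. -/
lemma lintegral_pathMeasure (G : Game S A) (σ : G.CtrlStrategy) (π : G.EnvStrategy) (s : S)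
    (f : Step S A → ℝ≥0∞) (n : ℕ) :
    ∫⁻ ω, f (ω n) ∂(G.pathMeasure σ π s) =
      mean (G.firstStep σ π s) ((G.stepMean σ π)^[n] f) := by
  induction n generalizing f with
  | zero => exact lintegral_pathMeasure_zero G σ π s f
  | succ n ih => rw [lintegral_pathMeasure_succ, ih, Function.iterate_succ_apply]

/-- The expected total reward accumulated from a given step on. -/
def stepReward (G : Game S A) (r : S → A → ℝ≥0) (σ : G.CtrlStrategy) (π : G.EnvStrategy)
    (e : Step S A) : ℝ≥0∞ :=
  ∑' n, (G.stepMean σ π)^[n] (fun e => (r e.1 e.2 : ℝ≥0∞)) e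

lemma expReward_eq_mean_stepReward (G : Game S A) (r : S → A → ℝ≥0) (σ : G.CtrlStrategy)
    (π : G.EnvStrategy) (s : S) :
    G.expReward r σ π s = mean (G.choice σ π s) fun a => G.stepReward r σ π (s, a) := by
  rw [← G.mean_firstStep σ π s (G.stepReward r σ π), expReward, MeasureTheory.lintegral_tsum]
  · unfold stepReward
    rw [mean_tsum]
    exact tsum_congr fun n => G.lintegral_pathMeasure σ π s (fun e => (r e.1 e.2 : ℝ≥0∞)) n
  · exact fun n => ((measurable_of_countable fun e : Step S A => (r e.1 e.2 : ℝ≥0∞)).comp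
      (measurable_pi_apply n)).aemeasurable

lemma stepReward_eq (G : Game S A) (r : S → A → ℝ≥0) (σ : G.CtrlStrategy) (π : G.EnvStrategy)
    (e : Step S A) :
    G.stepReward r σ π e = r e.1 e.2 + mean (G.δ e.1 e.2) (G.expReward r σ π) := by
  have h : mean (G.δ e.1 e.2) (G.expReward r σ π) = G.stepMean σ π (G.stepReward r σ π) e := by
    rw [stepMean_apply]
    congr 1
    ext t
    rw [expReward_eq_mean_stepReward, mean_firstStep]
  rw [h, stepReward, tsum_eq_zero_add' ENNReal.summable]
  congr 1
  unfold stepReward stepMean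
  rw [mean_tsum]
  simp only [Function.iterate_succ_apply']

lemma expReward_eq (G : Game S A) (r : S → A → ℝ≥0) (σ : G.CtrlStrategy) (π : G.EnvStrategy)
    (s : S) :
    G.expReward r σ π s =
      mean (G.choice σ π s) fun a => r s a + mean (G.δ s a) (G.expReward r σ π) := by
  rw [expReward_eq_mean_stepReward]
  exact congrArg _ (funext fun a => G.stepReward_eq r σ π (s, a))

/-- The expected total reward is the least prefixed point of its Bellman operator: rewards of
finite horizon stay below any other prefixed point. -/
lemma expReward_le_of_prefixed (G : Game S A) (r : S → A → ℝ≥0) (σ : G.CtrlStrategy)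
    (π : G.EnvStrategy) (V : S → ℝ≥0∞)
    (hV : ∀ s, mean (G.choice σ π s) (fun a => r s a + mean (G.δ s a) V) ≤ V s) (s : S) :
    G.expReward r σ π s ≤ V s := by
  set U : Step S A → ℝ≥0∞ := fun e => r e.1 e.2 + mean (G.δ e.1 e.2) V with hU
  have hstep : ∀ e : Step S A, (r e.1 e.2 : ℝ≥0∞) + G.stepMean σ π U e ≤ U e := by
    intro e
    rw [stepMean_apply]
    refine add_le_add_right (mean_mono _ fun t => ?_) _
    rw [mean_firstStep]
    exact hV t
  have hpart : ∀ (n : ℕ) (e : Step S A), ∑ i ∈ Finset.range n,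
      (G.stepMean σ π)^[i] (fun e => (r e.1 e.2 : ℝ≥0∞)) e ≤ U e := by
    intro n
    induction n with
    | zero => simp
    | succ n ih =>
      intro e
      rw [Finset.sum_range_succ', add_comm]
      -- The reward after the first step is at most the mean of `U`, by induction.
      refine le_trans (add_le_add_right ?_ _) (hstep e)
      simp only [Function.iterate_succ_apply']
      exact (mean_sum _ (G.nextStep σ π e) _).symm.trans_le (mean_mono _ ih)
  rw [expReward_eq_mean_stepReward]
  refine le_trans (mean_mono _ fun a => ?_) (hV s)
  exact ENNReal.tsum_le_of_sum_range_le fun n => hpart n (s, a)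

lemma expReward_smul (G : Game S A) (c : ℝ≥0) (r : S → A → ℝ≥0) (σ : G.CtrlStrategy)
    (π : G.EnvStrategy) (s : S) :
    G.expReward (c • r) σ π s = c * G.expReward r σ π s := by
  simp only [expReward, Pi.smul_apply, smul_eq_mul, ENNReal.coe_mul, ENNReal.tsum_mul_left]
  exact MeasureTheory.lintegral_const_mul' _ _ ENNReal.coe_ne_top

lemma maxReward_smul (G : Game S A) (c : ℝ≥0) (r : S → A → ℝ≥0) (s : S) :
    G.maxReward (c • r) s = c * G.maxReward r s := by
  simp only [maxReward, expReward_smul, ENNReal.mul_iSup]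

end Bellman

/-! ### Deterministic multi-strategies as allowances -/

/-- `B` is the family of sets of actions allowed by a deterministic multi-strategy, extended to
environment states by allowing every enabled action there. -/
structure IsAllowance (G : Game S A) (B : S → Finset A) : Prop where
  nonempty : ∀ s, (B s).Nonempty
  subset : ∀ s, B s ⊆ G.enabled s
  env : ∀ s ∉ G.diamond, B s = G.enabled s

/-- The deterministic multi-strategy allowing the actions in `B s` in the controller state `s`. -/
def IsAllowance.toMulti {G : Game S A} {B : S → Finset A} (hB : G.IsAllowance B) :
    G.MultiStrategy where
  allow s := PMF.pure (B s)
  nonempty s C hC := by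
    rw [PMF.mem_support_pure_iff] at hC
    exact hC ▸ hB.nonempty s
  enabled s C hC := by
    rw [PMF.mem_support_pure_iff] at hC
    exact hC ▸ hB.subset s

lemma IsAllowance.toMulti_deterministic {G : Game S A} {B : S → Finset A}
    (hB : G.IsAllowance B) : hB.toMulti.Deterministic :=
  fun s => ⟨B s, rfl⟩

lemma MultiStrategy.Deterministic.exists_allowance [DecidableEq S] {G : Game S A}
    {θ : G.MultiStrategy} (hθ : θ.Deterministic) :
    ∃ (B : S → Finset A) (hB : G.IsAllowance B), θ = hB.toMulti := by
  choose C hC using hθ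
  have hmem : ∀ s, C s ∈ (θ.allow s).support := fun s => by
    rw [hC, PMF.mem_support_pure_iff]
  refine ⟨fun s => if h : s ∈ G.diamond then C ⟨s, h⟩ else G.enabled s, ⟨?_, ?_, ?_⟩, ?_⟩
  · intro s
    split_ifs with h
    · exact θ.nonempty _ _ (hmem ⟨s, h⟩)
    · exact G.enabled_nonempty s
  · intro s
    split_ifs with h
    · exact θ.enabled _ _ (hmem ⟨s, h⟩)
    · exact subset_rfl
  · intro s h
    simp [h]
  · obtain ⟨allow, _, _⟩ := θ
    simp only [IsAllowance.toMulti, MultiStrategy.mk.injEq]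
    funext s
    simpa [s.2] using hC s

/-- The total penalty of the actions forbidden by `B` in controller states. -/
def forbiddenPenalty [Fintype S] [DecidableEq A] (G : Game S A) (B : S → Finset A)
    (ψ : G.Ctrl → A → ℝ≥0) : ℝ :=
  ∑ s : G.Ctrl, ∑ a ∈ G.enabled s \ B s, (ψ s a : ℝ)

lemma IsAllowance.staticPenalty_toMulti [Fintype S] [DecidableEq A] {G : Game S A}
    {B : S → Finset A} (hB : G.IsAllowance B) (ψ : G.Ctrl → A → ℝ≥0) :
    hB.toMulti.staticPenalty ψ = G.forbiddenPenalty B ψ := by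
  refine Finset.sum_congr rfl fun s _ => ?_
  rw [MultiStrategy.localPenalty,
    Finset.sum_eq_single_of_mem (B s) (Finset.mem_powerset.2 (hB.subset s))]
  · simp [toMulti]
  · intro C _ hC
    simp [toMulti, hC]

lemma forbiddenPenalty_smul [Fintype S] [DecidableEq A] (G : Game S A) (B : S → Finset A)
    (k : ℝ≥0) (ψ : G.Ctrl → A → ℝ≥0) :
    G.forbiddenPenalty B (k • ψ) = k * G.forbiddenPenalty B ψ := by
  simp [forbiddenPenalty, Finset.mul_sum]

lemma IsAllowance.complies_iff [DecidableEq A] {G : Game S A} {B : S → Finset A}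
    (hB : G.IsAllowance B) (σ : G.CtrlStrategy) :
    hB.toMulti.Complies σ ↔ ∀ s : G.Ctrl, ∀ a ∈ (σ.act s).support, a ∈ B s := by
  have hsum : ∀ (s : G.Ctrl) (d : Finset A → PMF A) (a : A),
      ∑ C ∈ (G.enabled s).powerset with a ∈ C, hB.toMulti.allow s C * d C a =
        if a ∈ B s then d (B s) a else 0 := by
    intro s d a
    rw [Finset.sum_filter,
      Finset.sum_eq_single_of_mem (B s) (Finset.mem_powerset.2 (hB.subset s))]
    · simp [toMulti]
    · intro C _ hC
      simp [toMulti, hC]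
  simp only [MultiStrategy.Complies, hsum]
  refine forall_congr' fun s => ⟨?_, ?_⟩
  · rintro ⟨d, -, hd⟩ a ha
    by_contra hna
    have := hd a (σ.enabled s a ha)
    rw [if_neg hna] at this
    exact ((PMF.mem_support_iff _ _).1 ha) this
  · intro h
    -- Only the distribution on `B s` matters; elsewhere any element of the set will do.
    refine ⟨fun C => if C = B s then σ.act s else
      if hC : C.Nonempty then PMF.pure hC.choose else σ.act s, ?_, ?_⟩
    · intro C hC _ a ha
      dsimp only at ha
      split_ifs at ha with h1
      · exact h1 ▸ h a ha
      · rw [PMF.mem_support_pure_iff] at ha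
        exact ha ▸ hC.choose_spec
    · intro a _
      split_ifs with ha
      · simp
      · exact (PMF.apply_eq_zero_iff _ _).2 fun h' => ha (h a h')

/-! ### The guaranteed reward -/

/-- The Bellman operator minimising over the actions in `B`. -/
def bellman (G : Game S A) (r : S → A → ℝ≥0) (B : S → Finset A) :
    (S → ℝ≥0∞) →o (S → ℝ≥0∞) where
  toFun V s := ⨅ a ∈ B s, (r s a + mean (G.δ s a) V)
  monotone' _ _ h _ := iInf₂_mono fun _ _ => add_le_add_right (mean_mono _ h) _

/-- The reward guaranteed when the actions in `B` are allowed: the least fixed point of the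
Bellman operator. -/
def value (G : Game S A) (r : S → A → ℝ≥0) (B : S → Finset A) : S → ℝ≥0∞ :=
  (G.bellman r B).lfp

lemma value_le (G : Game S A) (r : S → A → ℝ≥0) {B : S → Finset A} {s : S} {a : A}
    (ha : a ∈ B s) : G.value r B s ≤ r s a + mean (G.δ s a) (G.value r B) := by
  have h := congrFun (G.bellman r B).map_lfp s
  exact h.symm.trans_le (iInf₂_le a ha)

lemma value_le_of_prefixed (G : Game S A) (r : S → A → ℝ≥0) {B : S → Finset A} {V : S → ℝ≥0∞}
    (hV : ∀ s, ∃ a ∈ B s, r s a + mean (G.δ s a) V ≤ V s) : G.value r B ≤ V := by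
  refine (G.bellman r B).lfp_le fun s => ?_
  obtain ⟨a, ha, h⟩ := hV s
  exact (iInf₂_le a ha).trans h

lemma exists_greedy (G : Game S A) (r : S → A → ℝ≥0) {B : S → Finset A} (hB : G.IsAllowance B)
    (s : S) : ∃ a ∈ B s, G.value r B s = r s a + mean (G.δ s a) (G.value r B) := by
  obtain ⟨a, ha, hmin⟩ := (B s).exists_min_image
    (fun a => (r s a : ℝ≥0∞) + mean (G.δ s a) (G.value r B)) (hB.nonempty s)
  refine ⟨a, ha, (G.value_le r ha).antisymm ?_⟩
  have h := congrFun (G.bellman r B).map_lfp s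
  exact (le_iInf₂ hmin).trans_eq h

section Strategies

variable [DecidableEq S] [Finite S] [Finite A]

lemma value_le_expReward (G : Game S A) (r : S → A → ℝ≥0) {B : S → Finset A}
    (hB : G.IsAllowance B) (σ : G.CtrlStrategy) (π : G.EnvStrategy)
    (hσ : ∀ s : G.Ctrl, ∀ a ∈ (σ.act s).support, a ∈ B s) :
    G.value r B ≤ G.expReward r σ π := by
  refine (G.bellman r B).lfp_le fun s => ?_
  rw [expReward_eq]
  refine le_mean_of_support _ _ _ fun a ha => iInf₂_le a ?_
  unfold choice at ha
  split_ifs at ha with h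
  · exact hσ ⟨s, h⟩ a ha
  · rw [hB.env s h]
    exact π.enabled ⟨s, h⟩ a ha

/-- The greedy strategies for the guaranteed reward are optimal, as expected rewards are least
prefixed points. -/
lemma exists_expReward_le_value (G : Game S A) (r : S → A → ℝ≥0) {B : S → Finset A}
    (hB : G.IsAllowance B) :
    ∃ (σ : G.CtrlStrategy) (π : G.EnvStrategy),
      (∀ s : G.Ctrl, ∀ a ∈ (σ.act s).support, a ∈ B s) ∧
      G.expReward r σ π ≤ G.value r B := by
  choose g hgB hg using G.exists_greedy r hB
  have hsupp : ∀ s, ∀ a ∈ (PMF.pure (g s)).support, a ∈ B s := fun s a ha => by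
    rw [PMF.mem_support_pure_iff] at ha
    exact ha ▸ hgB s
  refine ⟨⟨fun s => PMF.pure (g s), fun s a ha => hB.subset s (hsupp s a ha)⟩,
    ⟨fun s => PMF.pure (g s), fun s a ha => hB.subset s (hsupp s a ha)⟩,
    fun s a ha => hsupp s a ha, fun s => ?_⟩
  refine expReward_le_of_prefixed _ _ _ _ _ (fun t => ?_) s
  have hc : ∀ h h', G.choice ⟨fun s => PMF.pure (g s), h⟩ ⟨fun s => PMF.pure (g s), h'⟩ t =
      PMF.pure (g t) := fun h h' => by
    unfold choice
    split_ifs <;> rfl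
  rw [hc, mean_pure]
  exact (hg t).ge

lemma value_le_maxReward (G : Game S A) (r : S → A → ℝ≥0) {B : S → Finset A}
    (hB : G.IsAllowance B) (s : S) : G.value r B s ≤ G.maxReward r s := by
  obtain ⟨σ, π, hσ, -⟩ := G.exists_expReward_le_value r hB
  exact (G.value_le_expReward r hB σ π hσ s).trans (le_iSup₂_of_le σ π le_rfl)

lemma IsAllowance.sound_iff [DecidableEq A] {G : Game S A} {B : S → Finset A}
    (hB : G.IsAllowance B) (r : S → A → ℝ≥0) (b : ℝ) :
    hB.toMulti.Sound r b ↔ ENNReal.ofReal b ≤ G.value r B G.init := by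
  simp only [MultiStrategy.Sound, hB.complies_iff, CtrlStrategy.Sound]
  constructor
  · intro h
    obtain ⟨σ, π, hσ, hle⟩ := G.exists_expReward_le_value r hB
    exact (h σ hσ π).trans (hle _)
  · exact fun h σ hσ π => h.trans (G.value_le_expReward r hB σ π hσ _)

lemma MultiStrategy.sound_smul_iff [DecidableEq A] {G : Game S A} (θ : G.MultiStrategy)
    (r : S → A → ℝ≥0) (b : ℝ) {c : ℝ≥0} (hc : 0 < c) :
    θ.Sound (c • r) (c * b) ↔ θ.Sound r b := by
  refine forall_congr' fun σ => imp_congr_right fun _ => forall_congr' fun π => ?_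
  rw [expReward_smul, ENNReal.ofReal_mul c.coe_nonneg, ENNReal.ofReal_coe_nnreal]
  exact ENNReal.mul_le_mul_iff_right (by simpa using hc.ne') ENNReal.coe_ne_top

end Strategies

/-! ### Feasible assignments from allowances -/

section Ranking

variable [Fintype S]

/-- The states from which, against any choice of actions in `B`, a positive reward is possible
within `n` steps. -/
def rewardWithin (G : Game S A) (r : S → A → ℝ≥0) (B : S → Finset A) : ℕ → Set S
  | 0 => ∅
  | n + 1 => {s | ∀ a ∈ B s, 0 < r s a ∨ ∃ t ∈ G.succ s a, t ∈ rewardWithin G r B n}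

lemma rewardWithin_mono (G : Game S A) (r : S → A → ℝ≥0) (B : S → Finset A) :
    Monotone (G.rewardWithin r B) := by
  refine monotone_nat_of_le_succ fun n => ?_
  induction n with
  | zero => exact Set.empty_subset _
  | succ n ih =>
    exact fun s hs a ha => (hs a ha).imp_right fun ⟨t, ht, h⟩ => ⟨t, ht, ih h⟩

lemma succ_nonempty (G : Game S A) (s : S) (a : A) : (G.succ s a).Nonempty := by
  obtain ⟨t, ht⟩ := (G.δ s a).support_nonempty
  exact ⟨t, by simpa [succ] using ht⟩

lemma exists_pos_le_reward [Finite A] (r : S → A → ℝ≥0) :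
    ∃ ε : ℝ, 0 < ε ∧ ε ≤ 1 ∧ ∀ s a, 0 < r s a → ε ≤ r s a := by
  cases nonempty_fintype A
  obtain ⟨q, -, hq⟩ := (Finset.univ : Finset (Option (S × A))).exists_min_image
    (fun q => q.elim (1 : ℝ) fun q => if 0 < r q.1 q.2 then (r q.1 q.2 : ℝ) else 1)
    ⟨none, Finset.mem_univ _⟩
  refine ⟨_, ?_, hq none (Finset.mem_univ _), fun s a h => ?_⟩
  · cases q with
    | none => exact one_pos
    | some q =>
      simp only [Option.elim]
      split_ifs with h
      · exact_mod_cast h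
      · exact one_pos
  · simpa [h] using hq (some (s, a)) (Finset.mem_univ _)

/-- The ranking function is a small multiple of the number of steps within which a positive
reward is possible; `U` is the set of states where this number is finite. -/
lemma exists_ranking [Finite A] (G : Game S A) (r : S → A → ℝ≥0) (B : S → Finset A) :
    ∃ (U : Set S) (γ : S → ℝ), (∀ s, 0 ≤ γ s ∧ γ s < 1) ∧
      (∀ s ∈ U, ∀ a ∈ B s, ∃ t ∈ G.succ s a, γ t < γ s + r s a) ∧
      ∀ s ∉ U, ∃ a ∈ B s, r s a = 0 ∧ ∀ t ∈ G.succ s a, t ∉ U := by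
  classical
  set U : Set S := {s | ∃ n, s ∈ G.rewardWithin r B n} with hU
  set rank : S → ℕ := fun s => sInf {n | s ∈ G.rewardWithin r B n} with hrank
  set N : ℕ := Finset.univ.sup rank with hN
  have hrN : ∀ s, rank s ≤ N := fun s => Finset.le_sup (f := rank) (Finset.mem_univ s)
  have hmem : ∀ s ∈ U, s ∈ G.rewardWithin r B (rank s) := fun s hs => Nat.sInf_mem hs
  obtain ⟨ε, hε, hε1, hεr⟩ := exists_pos_le_reward r
  have hN1 : (0 : ℝ) < N + 1 := by positivity
  have hlt : ∀ s, ε * (rank s / (N + 1)) < ε := fun s => by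
    refine mul_lt_of_lt_one_right hε ((div_lt_one hN1).2 ?_)
    exact_mod_cast Nat.lt_succ_of_le (hrN s)
  have hnn : ∀ s, 0 ≤ ε * ((rank s : ℝ) / (N + 1)) := fun s => by positivity
  refine ⟨U, fun s => ε * (rank s / (N + 1)), fun s => ⟨hnn s, (hlt s).trans_le hε1⟩, ?_, ?_⟩
  · intro s hs a ha
    obtain ⟨m, hm⟩ : ∃ m, rank s = m + 1 := by
      refine Nat.exists_eq_succ_of_ne_zero fun h0 => ?_
      have := hmem s hs
      rwa [h0] at this
    have h := hmem s hs
    rw [hm] at h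
    -- A positive reward is at least `ε` and thus exceeds every value of the ranking, so any
    -- successor will do; otherwise a successor of smaller rank exists.
    rcases h a ha with h | ⟨t, ht, htm⟩
    · obtain ⟨t, ht⟩ := G.succ_nonempty s a
      exact ⟨t, ht, by linarith [hlt t, hnn s, hεr s a h]⟩
    · refine ⟨t, ht, ?_⟩
      have hts : (rank t : ℝ) < rank s := by
        exact_mod_cast (hm ▸ Nat.lt_succ_of_le (Nat.sInf_le htm) : rank t < rank s)
      have : ε * ((rank t : ℝ) / (N + 1)) < ε * ((rank s : ℝ) / (N + 1)) := by gcongr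
      have := (r s a).coe_nonneg
      linarith
  · intro s hs
    -- As ranks are bounded by `N`, a state all of whose allowed actions yield a reward or may
    -- lead into `U` gets a rank of at most `N + 1`.
    by_contra! hcon
    refine hs ⟨N + 1, fun a ha => ?_⟩
    rcases eq_or_ne (r s a) 0 with h0 | h0
    · obtain ⟨t, ht, htU⟩ := hcon a ha h0
      exact Or.inr ⟨t, ht, G.rewardWithin_mono r B (hrN t) (hmem t htU)⟩
    · exact Or.inl (pos_iff_ne_zero.2 h0)

end Ranking

/-- Restricting the value to `U` gives another prefixed point if, off `U`, some allowed action
yields no reward and stays off `U`. -/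
lemma value_eq_zero [Fintype S] (G : Game S A) (r : S → A → ℝ≥0) {B : S → Finset A}
    (hB : G.IsAllowance B) (U : Set S)
    (hU : ∀ s ∉ U, ∃ a ∈ B s, r s a = 0 ∧ ∀ t ∈ G.succ s a, t ∉ U) {s : S} (hs : s ∉ U) :
    G.value r B s = 0 := by
  have h := G.value_le_of_prefixed r (B := B) (V := U.indicator (G.value r B)) fun s => by
    by_cases hs : s ∈ U
    · obtain ⟨a, ha, h⟩ := G.exists_greedy r hB s
      refine ⟨a, ha, ?_⟩
      rw [Set.indicator_of_mem hs, h]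
      exact add_le_add_right (mean_mono _ (Set.indicator_le_self _ _)) _
    · obtain ⟨a, ha, h0, ht⟩ := hU s hs
      refine ⟨a, ha, ?_⟩
      rw [h0, mean_eq_zero_of_support]
      · simp
      · exact fun t htS => Set.indicator_of_notMem (ht t (by simpa [succ] using htS)) _
  simpa [hs] using h s

/-- In states without positive guaranteed reward all actions are allowed: this leaves the
guaranteed reward unchanged, and the constraint on `y` demands it where `α` vanishes. -/
lemma exists_feasible [Fintype S] [DecidableEq S] [Finite A] [DecidableEq A] (G : Game S A)
    (r : S → A → ℝ≥0) (hr : ∀ s, G.maxReward r s < 1) (b : ℝ) {B : S → Finset A}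
    (hB : G.IsAllowance B) (hb : ENNReal.ofReal b ≤ G.value r B G.init) (ψ : G.Ctrl → A → ℝ≥0) :
    ∃ v, G.Feasible r b v ∧ v.x G.init = (G.value r B G.init).toReal ∧
      G.penaltyTerm ψ v ≤ G.forbiddenPenalty B ψ := by
  classical
  obtain ⟨U, γ, hγ, hUγ, hU⟩ := G.exists_ranking r B
  have hlt : ∀ s, G.value r B s < 1 := fun s => (G.value_le_maxReward r hB s).trans_lt (hr s)
  have htop : ∀ s, G.value r B s ≠ ⊤ := fun s => ((hlt s).trans ENNReal.one_lt_top).ne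
  have hx1 : ∀ s, (G.value r B s).toReal ≤ 1 := fun s =>
    ENNReal.toReal_le_of_le_ofReal zero_le_one (by simpa using (hlt s).le)
  have hx0 : ∀ s ∉ U, (G.value r B s).toReal = 0 := fun s hs => by
    rw [G.value_eq_zero r hB U hU hs, ENNReal.toReal_zero]
  have hnn : ∀ s a, 0 ≤ ∑ t, (G.δ s a t).toReal * (G.value r B t).toReal + (r s a : ℝ) :=
    fun s a => by positivity
  have hbell : ∀ s, ∀ a ∈ B s, (G.value r B s).toReal ≤
      ∑ t, (G.δ s a t).toReal * (G.value r B t).toReal + r s a := fun s a ha => by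
    have h := ENNReal.toReal_mono
      (ENNReal.add_ne_top.2 ⟨ENNReal.coe_ne_top, mean_ne_top _ htop⟩) (G.value_le r ha)
    rw [ENNReal.toReal_add ENNReal.coe_ne_top (mean_ne_top _ htop), toReal_mean _ htop] at h
    rw [add_comm]
    exact h
  choose! τ hτ hτγ using hUγ
  let v : Assignment S A :=
    { x := fun s => (G.value r B s).toReal
      y := fun s a => if s ∈ U → a ∈ B s then 1 else 0
      α := fun s => if s ∈ U then 1 else 0
      β := fun s a t => if s ∈ U ∧ a ∈ B s ∧ t = τ s a then 1 else 0
      γ := γ }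
  have hy : ∀ s, ∀ a ∈ B s, v.y s a = 1 := fun s a ha => if_pos fun _ => ha
  have hy01 : ∀ s a, v.y s a = 0 ∨ v.y s a = 1 := fun s a => by
    simp only [v]; split_ifs <;> simp
  refine ⟨v, ?_, rfl, ?_⟩
  · refine
      { x_range := fun s => ⟨ENNReal.toReal_nonneg, hx1 s⟩
        y_range := hy01
        α_range := fun s => ?_
        β_range := fun s a t => ?_
        γ_range := fun s => ⟨(hγ s).1, (hγ s).2.le⟩
        bound := (ENNReal.ofReal_le_iff_le_toReal (htop _)).1 hb
        allowed := fun s _ => ?_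
        ctrl := fun s _ a _ => ?_
        env := fun s hs a ha => hbell s a (by rwa [hB.env s hs])
        positive := fun s => ?_
        select := fun s a _ => ?_
        env_allowed := fun s hs a ha => hy s a (by rwa [hB.env s hs])
        ranking := fun s a _ t _ => ?_ }
    · simp only [v]; split_ifs <;> simp
    · simp only [v]; split_ifs <;> simp
    · obtain ⟨a, ha⟩ := hB.nonempty s
      rw [← hy s a ha]
      refine Finset.single_le_sum (f := v.y s) (fun a _ => ?_) (hB.subset s ha)
      rcases hy01 s a with h | h <;> simp [h]
    · by_cases hs : s ∈ U
      · by_cases ha : a ∈ B s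
        · rw [hy s a ha]
          simpa using hbell s a ha
        · have : v.y s a = 0 := if_neg fun h => ha (h hs)
          rw [this]
          linarith [hx1 s, hnn s a]
      · have hy1 : v.y s a = 1 := if_pos fun h => absurd h hs
        have h0 : v.x s = 0 := hx0 s hs
        rw [hy1, h0]
        linarith [hnn s a]
    · simp only [v]
      split_ifs with hs
      · exact hx1 s
      · exact (hx0 s hs).le
    · by_cases hs : s ∈ U
      · by_cases ha : a ∈ B s
        · simp [v, hs, ha, hτ s hs a ha]
        · simp [v, hs, ha]
      · simp [v, hs]
    · have h := (r s a).coe_nonneg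
      simp only [v]
      split_ifs with hc
      · obtain ⟨hs, ha, rfl⟩ := hc
        linarith [hτγ s hs a ha]
      · linarith [(hγ t).2, (hγ s).1]
  · refine Finset.sum_le_sum fun s _ => ?_
    rw [← Finset.sum_subset (Finset.sdiff_subset (s := G.enabled s) (t := B s))]
    · refine Finset.sum_le_sum fun a _ => mul_le_of_le_one_left (ψ s a).coe_nonneg ?_
      rcases hy01 s a with h | h <;> simp [h]
    · intro a ha hna
      have : a ∈ B s := by
        by_contra h
        exact hna (Finset.mem_sdiff.2 ⟨ha, h⟩)
      rw [hy s a this]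
      simp

/-! ### Allowances from feasible assignments -/

section Selected

/-- The actions selected by the `y`-variables of an assignment. -/
def selected (G : Game S A) (v : Assignment S A) (s : S) : Finset A :=
  {a ∈ G.enabled s | v.y s a = 1}

variable [Fintype S] {G : Game S A} {r : S → A → ℝ≥0} {b : ℝ} {v : Assignment S A}

lemma Feasible.isAllowance_selected (hv : G.Feasible r b v) : G.IsAllowance (G.selected v) where
  nonempty s := by
    by_cases hs : s ∈ G.diamond
    · obtain ⟨a, ha, h⟩ := Finset.exists_ne_zero_of_sum_ne_zero
        (zero_lt_one.trans_le (hv.allowed s hs)).ne'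
      exact ⟨a, Finset.mem_filter.2 ⟨ha, (hv.y_range s a).resolve_left h⟩⟩
    · obtain ⟨a, ha⟩ := G.enabled_nonempty s
      exact ⟨a, Finset.mem_filter.2 ⟨ha, hv.env_allowed s hs a ha⟩⟩
  subset s := Finset.filter_subset _ _
  env s hs := Finset.filter_true_of_mem (hv.env_allowed s hs)

lemma Feasible.penaltyTerm_eq [DecidableEq S] [DecidableEq A] (hv : G.Feasible r b v)
    (ψ : G.Ctrl → A → ℝ≥0) : G.penaltyTerm ψ v = G.forbiddenPenalty (G.selected v) ψ := by
  refine Finset.sum_congr rfl fun s _ => ?_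
  rw [selected, ← Finset.filter_not, Finset.sum_filter]
  refine Finset.sum_congr rfl fun a _ => ?_
  rcases hv.y_range s a with h | h <;> simp [h]

/-- A mean that reaches the upper bound `M` forces `f = M` on the support. -/
lemma eq_of_le_sum_mul (p : PMF S) {f : S → ℝ} {M : ℝ} (hf : ∀ t ∈ p.support, f t ≤ M)
    (h : M ≤ ∑ t, (p t).toReal * f t) : ∀ t ∈ p.support, f t = M := by
  have hp : ∑ t, (p t).toReal = 1 := by
    rw [← ENNReal.toReal_sum fun t _ => p.apply_ne_top t, ← tsum_fintype (L := .unconditional S),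
      p.tsum_coe, ENNReal.toReal_one]
  have hterm : ∀ t ∈ Finset.univ, 0 ≤ (p t).toReal * (M - f t) := fun t _ => by
    by_cases ht : t ∈ p.support
    · exact mul_nonneg ENNReal.toReal_nonneg (sub_nonneg.2 (hf t ht))
    · simp [(PMF.apply_eq_zero_iff p t).2 ht]
  have hsum : ∑ t, (p t).toReal * (M - f t) = 0 := by
    refine le_antisymm ?_ (Finset.sum_nonneg hterm)
    simp only [mul_sub, Finset.sum_sub_distrib, ← Finset.sum_mul, hp, one_mul]
    linarith
  intro t ht
  have h0 := (Finset.sum_eq_zero_iff_of_nonneg hterm).1 hsum t (Finset.mem_univ t)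
  have hpt : (p t).toReal ≠ 0 :=
    (ENNReal.toReal_pos ((PMF.mem_support_iff p t).1 ht) (p.apply_ne_top t)).ne'
  linarith [(mul_eq_zero.1 h0).resolve_left hpt]

/-- The `x`-variables are bounded by the guaranteed reward `w`. Otherwise, under greedy actions,
the states maximising `x - w > 0` form a closed set, and so do those among them minimising `w`.
Rewards vanish in the latter set, so a state minimising `γ` in it violates the ranking. -/
lemma Feasible.x_le_value (hv : G.Feasible r b v) (htop : ∀ s, G.value r (G.selected v) s ≠ ⊤)
    (s : S) : v.x s ≤ (G.value r (G.selected v) s).toReal := by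
  classical
  choose g hgB hg using G.exists_greedy r hv.isAllowance_selected
  set w : S → ℝ := fun s => (G.value r (G.selected v) s).toReal with hw
  have hw0 : ∀ s, 0 ≤ w s := fun s => ENNReal.toReal_nonneg
  have hwg : ∀ s, w s = r s (g s) + ∑ t, (G.δ s (g s) t).toReal * w t := fun s => by
    simp only [hw]
    rw [← toReal_mean _ htop, hg s,
      ENNReal.toReal_add ENNReal.coe_ne_top (mean_ne_top _ htop), ENNReal.coe_toReal]
  have hge : ∀ s, g s ∈ G.enabled s := fun s => (Finset.mem_filter.1 (hgB s)).1
  have hgy : ∀ s, v.y s (g s) = 1 := fun s => (Finset.mem_filter.1 (hgB s)).2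
  have hxg : ∀ s, v.x s ≤ ∑ t, (G.δ s (g s) t).toReal * v.x t + r s (g s) := fun s => by
    by_cases hs : s ∈ G.diamond
    · have := hv.ctrl s hs _ (hge s)
      rwa [hgy, sub_self, add_zero] at this
    · exact hv.env s hs _ (hge s)
  have hDg : ∀ s, v.x s - w s ≤ ∑ t, (G.δ s (g s) t).toReal * (v.x t - w t) := fun s => by
    simp only [mul_sub, Finset.sum_sub_distrib]
    linarith [hxg s, hwg s]
  by_contra! hlt
  obtain ⟨s₁, -, hs₁⟩ := Finset.univ.exists_max_image (fun s => v.x s - w s) ⟨s, Finset.mem_univ s⟩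
  set M := v.x s₁ - w s₁ with hM
  have hle : ∀ t, v.x t - w t ≤ M := fun t => hs₁ t (Finset.mem_univ t)
  have hMpos : 0 < M := by linarith [hle s]
  set C : Finset S := {s | v.x s - w s = M} with hC
  have hCclosed : ∀ s ∈ C, ∀ t ∈ (G.δ s (g s)).support, t ∈ C := fun s hs t ht => by
    simp only [hC, Finset.mem_filter_univ] at hs ⊢
    exact eq_of_le_sum_mul _ (fun t _ => hle t) (hs.symm.trans_le (hDg s)) t ht
  obtain ⟨s₂, hs₂C, hs₂⟩ := C.exists_min_image w ⟨s₁, by simp [hC, hM]⟩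
  set C' : Finset S := {s ∈ C | w s = w s₂} with hC'
  have hC'closed : ∀ s ∈ C', r s (g s) = 0 ∧ ∀ t ∈ (G.δ s (g s)).support, t ∈ C' := by
    intro s hs
    obtain ⟨hsC, hsw⟩ := Finset.mem_filter.1 hs
    have hr := (r s (g s)).coe_nonneg
    -- No successor has a smaller value, so the Bellman equation at `s` leaves no room for a reward.
    have heq := eq_of_le_sum_mul (G.δ s (g s)) (f := fun t => -w t) (M := -w s₂)
      (fun t ht => neg_le_neg (hs₂ t (hCclosed s hsC t ht))) (by
        simp only [mul_neg, Finset.sum_neg_distrib]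
        linarith [hwg s])
    refine ⟨?_, fun t ht => Finset.mem_filter.2 ⟨hCclosed s hsC t ht, neg_injective (heq t ht)⟩⟩
    have hmean := le_mean_of_support (G.δ s (g s)) (G.value r (G.selected v))
      (G.value r (G.selected v) s) fun t ht => by
        rw [← ENNReal.toReal_le_toReal (htop _) (htop _)]
        change w s ≤ w t
        rw [hsw, neg_injective (heq t ht)]
    have hmean' := ENNReal.toReal_mono (mean_ne_top _ htop) hmean
    rw [toReal_mean _ htop] at hmean'
    change w s ≤ ∑ t, (G.δ s (g s) t).toReal * w t at hmean'
    exact_mod_cast (by linarith [hwg s] : (r s (g s) : ℝ) ≤ 0).antisymm hr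
  obtain ⟨s₃, hs₃, hγ⟩ := C'.exists_min_image v.γ ⟨s₂, Finset.mem_filter.2 ⟨hs₂C, rfl⟩⟩
  obtain ⟨hr0, hclosed⟩ := hC'closed s₃ hs₃
  have hs₃M : v.x s₃ - w s₃ = M := by
    simpa [hC] using (Finset.mem_filter.1 hs₃).1
  have hα : v.α s₃ = 1 := by
    refine (hv.α_range s₃).resolve_left fun h => ?_
    linarith [hv.positive s₃, hw0 s₃]
  have hβ : ∑ t ∈ G.succ s₃ (g s₃), v.β s₃ (g s₃) t ≠ 0 := by
    have := hv.select s₃ _ (hge s₃)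
    rw [hgy, hα, sub_self, zero_add] at this
    exact this ▸ one_ne_zero
  obtain ⟨t, ht, hβt⟩ := Finset.exists_ne_zero_of_sum_ne_zero hβ
  have hrank := hv.ranking s₃ _ (hge s₃) t ht
  rw [(hv.β_range _ _ _).resolve_left hβt, hr0] at hrank
  have htC : t ∈ C' := hclosed t (by simpa [succ] using ht)
  have := hγ t htC
  simp only [sub_self, NNReal.coe_zero, add_zero] at hrank
  linarith

end Selected

/-! ### Optimal assignments -/

section Optimal

variable [Fintype S] [DecidableEq S] [Finite A] {G : Game S A}
  {r : S → A → ℝ≥0} {b : ℝ} {ψ : G.Ctrl → A → ℝ≥0}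

lemma value_ne_top (hr : ∀ s, G.maxReward r s < 1) {B : S → Finset A} (hB : G.IsAllowance B)
    (s : S) : G.value r B s ≠ ⊤ :=
  (((G.value_le_maxReward r hB s).trans_lt (hr s)).trans ENNReal.one_lt_top).ne

lemma Feasible.x_init_lt_one (hr : ∀ s, G.maxReward r s < 1) {v : Assignment S A}
    (hv : G.Feasible r b v) : v.x G.init < 1 := by
  have hB := hv.isAllowance_selected
  refine (hv.x_le_value (value_ne_top hr hB) G.init).trans_lt ?_
  have h := (G.value_le_maxReward r hB G.init).trans_lt (hr G.init)
  simpa using (ENNReal.toReal_lt_toReal (value_ne_top hr hB _) ENNReal.one_ne_top).2 h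

lemma Feasible.ofReal_le_value (hr : ∀ s, G.maxReward r s < 1) {v : Assignment S A}
    (hv : G.Feasible r b v) : ENNReal.ofReal b ≤ G.value r (G.selected v) G.init :=
  ENNReal.ofReal_le_of_le_toReal
    (hv.bound.trans (hv.x_le_value (value_ne_top hr hv.isAllowance_selected) G.init))

variable [DecidableEq A]

/-- Minimising the objective over assignments amounts to minimising the penalty of forbidden
actions minus the guaranteed reward over the finitely many sound allowances. -/
lemma exists_optimalAssignment (hr : ∀ s, G.maxReward r s < 1) {B : S → Finset A}
    (hB : G.IsAllowance B) (hb : ENNReal.ofReal b ≤ G.value r B G.init) :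
    ∃ v, G.OptimalAssignment r b ψ v := by
  cases nonempty_fintype A
  let T := {B : S → Finset A // G.IsAllowance B ∧ ENNReal.ofReal b ≤ G.value r B G.init}
  have : Nonempty T := ⟨⟨B, hB, hb⟩⟩
  obtain ⟨⟨B₀, hB₀, hb₀⟩, hmin⟩ := Finite.exists_min fun B : T =>
    -(G.value r B.1 G.init).toReal + G.forbiddenPenalty B.1 ψ
  obtain ⟨v, hv, hvx, hvp⟩ := G.exists_feasible r hr b hB₀ hb₀ ψ
  refine ⟨v, hv, fun w hw => ?_⟩
  have h1 := hmin ⟨G.selected w, hw.isAllowance_selected, hw.ofReal_le_value hr⟩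
  have h2 := hw.x_le_value (value_ne_top hr hw.isAllowance_selected) G.init
  rw [objective, objective, hw.penaltyTerm_eq, hvx]
  simp only at h1
  linarith

/-- The reward part of the objective lies in `(-1, 0]`, so under the scaling conditions it cannot
outweigh a difference of penalties. -/
lemma OptimalAssignment.penaltyTerm_le {k : ℝ≥0} (hs : G.Rescaled r (k • ψ)) (hk : 0 < k)
    {v : Assignment S A} (hv : G.OptimalAssignment r b (k • ψ) v) {B : S → Finset A}
    (hB : G.IsAllowance B) (hb : ENNReal.ofReal b ≤ G.value r B G.init) :
    G.penaltyTerm ψ v ≤ G.forbiddenPenalty B ψ := by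
  obtain ⟨hv, hmin⟩ := hv
  have hk' : (0 : ℝ) < k := hk
  have hBv := hv.isAllowance_selected
  rw [hv.penaltyTerm_eq]
  by_contra! hlt
  have hlt' : G.forbiddenPenalty B (k • ψ) < G.forbiddenPenalty (G.selected v) (k • ψ) := by
    rw [forbiddenPenalty_smul, forbiddenPenalty_smul]
    exact mul_lt_mul_of_pos_left hlt hk'
  have hgap := hs.2 hBv.toMulti hB.toMulti hBv.toMulti_deterministic hB.toMulti_deterministic
  rw [hBv.staticPenalty_toMulti, hB.staticPenalty_toMulti, abs_of_pos (sub_pos.2 hlt')] at hgap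
  have hgap := hgap hlt'.ne'
  obtain ⟨w, hw, hwx, hwp⟩ := G.exists_feasible r hs.1 b hB hb (k • ψ)
  have hobj := hmin w hw
  rw [objective, objective, hv.penaltyTerm_eq] at hobj
  linarith [hv.x_init_lt_one hs.1, (hw.x_range G.init).1]

end Optimal

/-! ### Scaling factors -/

lemma exists_separating_factor {ι : Type*} [Finite ι] (f : ι → ℝ) :
    ∃ k : ℝ≥0, 0 < k ∧ ∀ i j, f i ≠ f j → 1 ≤ k * |f i - f j| := by
  cases nonempty_fintype ι
  refine ⟨1 + ∑ q : ι × ι, ‖f q.1 - f q.2‖₊⁻¹, by positivity, fun i j hij => ?_⟩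
  have hpos : ‖f i - f j‖₊ ≠ 0 := nnnorm_ne_zero_iff.2 (sub_ne_zero.2 hij)
  have hle : ‖f i - f j‖₊⁻¹ ≤ 1 + ∑ q : ι × ι, ‖f q.1 - f q.2‖₊⁻¹ :=
    (Finset.single_le_sum (f := fun q : ι × ι => ‖f q.1 - f q.2‖₊⁻¹) (fun _ _ => zero_le)
      (Finset.mem_univ (i, j))).trans le_add_self
  have h : 1 ≤ (1 + ∑ q : ι × ι, ‖f q.1 - f q.2‖₊⁻¹) * ‖f i - f j‖₊ :=
    (inv_mul_cancel₀ hpos).symm.trans_le (mul_le_mul_left hle _)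
  rw [← Real.norm_eq_abs, ← coe_nnnorm]
  exact_mod_cast h

/-- A deterministic multi-strategy is an allowance, and these are finite in number, so one factor
separates their penalties. -/
lemma exists_rescaled [Fintype S] [DecidableEq S] [Finite A] [DecidableEq A] (G : Game S A)
    (r : S → A → ℝ≥0) (hr : ∀ s, G.maxReward r s < ⊤) (ψ : G.Ctrl → A → ℝ≥0) :
    ∃ c k : ℝ≥0, 0 < c ∧ 0 < k ∧ G.Rescaled (c • r) (k • ψ) := by
  cases nonempty_fintype A
  obtain ⟨k, hk, hsep⟩ := exists_separating_factor fun B : S → Finset A => G.forbiddenPenalty B ψ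
  set m : ℝ≥0 := ∑ s, (G.maxReward r s).toNNReal with hm
  have hm1 : 0 < m + 1 := by positivity
  refine ⟨(m + 1)⁻¹, k, inv_pos.2 hm1, hk, fun s => ?_, fun θ θ' hθ hθ' hne => ?_⟩
  · rw [maxReward_smul, ← ENNReal.coe_toNNReal (hr s).ne, ← ENNReal.coe_mul]
    have hle : (G.maxReward r s).toNNReal ≤ m :=
      Finset.single_le_sum (f := fun s => (G.maxReward r s).toNNReal) (fun _ _ => zero_le)
        (Finset.mem_univ s)
    have h : (m + 1)⁻¹ * (G.maxReward r s).toNNReal < 1 := by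
      rw [inv_mul_lt_one₀ hm1]
      exact lt_add_of_le_of_pos hle one_pos
    exact_mod_cast h
  · obtain ⟨B, hB, rfl⟩ := hθ.exists_allowance
    obtain ⟨B', hB', rfl⟩ := hθ'.exists_allowance
    rw [hB.staticPenalty_toMulti, hB'.staticPenalty_toMulti, forbiddenPenalty_smul,
      forbiddenPenalty_smul] at hne ⊢
    rw [← mul_sub, abs_mul, NNReal.abs_eq]
    exact hsep B B' fun h => hne (h ▸ rfl)

end Game
end PermissiveSynthesis
end

theorem mainTheorem6 {S A : Type*} [Fintype S] [DecidableEq S] [Finite A] [DecidableEq A]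
    (G : PermissiveSynthesis.Game S A)
    (r : S → A → ℝ≥0) (hr : ∀ s, G.maxReward r s < ⊤)
    (b : ℝ) (ψ : G.Ctrl → A → ℝ≥0) :
    (∃ c k : ℝ≥0, 0 < c ∧ 0 < k ∧ G.Rescaled (c • r) (k • ψ)) ∧
    ∀ c k : ℝ≥0, 0 < c → 0 < k → G.Rescaled (c • r) (k • ψ) → ∀ p : ℝ,
      (∃ θ : G.MultiStrategy, θ.OptimallyPermissive r b ψ ∧ θ.staticPenalty ψ = p) ↔
      (∃ v : PermissiveSynthesis.Assignment S A,
        G.OptimalAssignment (c • r) (c * b) (k • ψ) v ∧ p = G.penaltyTerm ψ v) := by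
  refine ⟨G.exists_rescaled r hr ψ, fun c k hc hk hs p => ?_⟩
  have hsound : ∀ {B : S → Finset A} (hB : G.IsAllowance B), hB.toMulti.Sound r b ↔
      ENNReal.ofReal (c * b) ≤ G.value (c • r) B G.init := fun hB => by
    rw [← hB.sound_iff, PermissiveSynthesis.Game.MultiStrategy.sound_smul_iff _ _ _ hc]
  constructor
  · rintro ⟨θ, ⟨hdet, hθ, hglb⟩, rfl⟩
    obtain ⟨B, hB, rfl⟩ := hdet.exists_allowance
    obtain ⟨v, hv⟩ := PermissiveSynthesis.Game.exists_optimalAssignment (ψ := k • ψ) hs.1 hB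
      ((hsound hB).1 hθ)
    refine ⟨v, hv, le_antisymm ?_ ?_⟩
    · have hBv := hv.1.isAllowance_selected
      refine hglb.1 ⟨hBv.toMulti, hBv.toMulti_deterministic,
        (hsound hBv).2 (hv.1.ofReal_le_value hs.1), ?_⟩
      rw [hBv.staticPenalty_toMulti, hv.1.penaltyTerm_eq]
    · rw [hB.staticPenalty_toMulti]
      exact hv.penaltyTerm_le hs hk hB ((hsound hB).1 hθ)
  · rintro ⟨v, hv, rfl⟩
    have hBv := hv.1.isAllowance_selected
    have hBs := (hsound hBv).2 (hv.1.ofReal_le_value hs.1)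
    have hpen : hBv.toMulti.staticPenalty ψ = G.penaltyTerm ψ v := by
      rw [hBv.staticPenalty_toMulti, hv.1.penaltyTerm_eq]
    refine ⟨hBv.toMulti, ⟨hBv.toMulti_deterministic, hBs,
      IsLeast.isGLB ⟨⟨_, hBv.toMulti_deterministic, hBs, rfl⟩, ?_⟩⟩, hpen⟩
    rintro q ⟨θ, hdet, hθ, rfl⟩
    obtain ⟨B, hB, rfl⟩ := hdet.exists_allowance
    rw [hpen, hB.staticPenalty_toMulti]
    exact hv.penaltyTerm_le hs hk hB ((hsound hB).1 hθ)
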